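/- In $L^2(\mathbb R)$ let $\hat T_0$ be the operator of multiplication by $s\mapsto(s^2+2)^{-1/2}$ and, for $\theta\in(0,\pi)$, let $\hat T_\theta$ be the integral operator with kernel $$\hat T_\theta(t,s)=\frac1{2\pi|\sin\theta|}\,\frac1{\frac{t^2-2ts\cos\theta+s^2}{2\sin^2\theta}+1}.$$ Let $(\Pi\varphi)(s)=\varphi(-s)$ and $\hat T_\theta^-=\frac{1-\Pi}2\hat T_\theta$. Then for every $\theta\in(0,\pi)$ the operator $$(2^{-1/2}-\hat T_0)^{-1/2}\,\hat T_\theta^-\,(2^{-1/2}-\hat T_0)^{-1/2},$$ defined on its natural domain, is densely defined and extends to a (unique) bounded operator $\widetilde T_\theta^-$ on $L^2(\mathbb R)$, and $\widetilde T_\theta^-$ is trace class. Its trace norm $\|\cdot\|_1$ satisfies, for all $0<\theta<\pi/2$, $$\|\widetilde T_\theta^-\|_1\le\frac{4\sin\theta\,\tanh^{-1}(\cos\theta)+\pi\left(9\cos\frac\theta2-\cos\frac{5\theta}2-9\sin\frac\theta2+\sin\frac{5\theta}2\right)}{4\pi\sin^2\theta}.$$ In particular $$\|\widetilde T_{2\pi/3}^-\|_1=\|\widetilde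 T_{\pi/3}^-\|_1\le-\frac43+\frac5{\sqrt3}+\frac{\log3}{\sqrt3\,\pi}\approx1.75532,$$ where the numerical value is accurate to within $10^{-5}$. -/

import Mathlib

open MeasureTheory Set
open scoped ENNReal InnerProductSpace

noncomputable section

namespace Scissor

section TraceClass

variable {H : Type*} [NormedAddCommGroup H] [InnerProductSpace ℂ H] [CompleteSpace H]

/-- The trace norm `‖S‖₁ = tr |S| = ∑ᵢ ⟪eᵢ, |S| eᵢ⟫`, where `|S| = (S* S)^{1/2}` and `(eᵢ)` is an
orthonormal basis of `H`. The sum does not depend on the basis, so the supremum over all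
orthonormal bases is this common value (`∞` exactly when `S` is not trace class). -/
def traceNorm (S : H →L[ℂ] H) : ℝ≥0∞ :=
  ⨆ (w : Set H) (b : HilbertBasis w ℂ H),
    ∑' i, ENNReal.ofReal (RCLike.re ⟪b i, (CFC.abs S) (b i)⟫_ℂ)

/-- `S` is trace class: `tr |S| < ∞`. -/
def IsTraceClass (S : H →L[ℂ] H) : Prop := traceNorm S < ∞

end TraceClass

section PartialOperators

variable {H : Type*} [NormedAddCommGroup H] [InnerProductSpace ℂ H]

/-- The composition `g f` of two (possibly unbounded) operators, with its natural domain
`{x ∈ dom f | f x ∈ dom g}`. -/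
def compNat (g f : H →ₗ.[ℂ] H) : H →ₗ.[ℂ] H :=
  g.comp (f.domRestrict ((g.domain.comap f.toFun).map f.domain.subtype)) (by
    rintro ⟨x, hx, hxf⟩
    obtain ⟨y, hy, rfl⟩ := hx
    exact hy)

theorem mem_compNat_domain (g f : H →ₗ.[ℂ] H) (x : H) :
    x ∈ (compNat g f).domain ↔ ∃ h : x ∈ f.domain, f ⟨x, h⟩ ∈ g.domain := by
  constructor
  · rintro ⟨⟨y, hy, rfl⟩, hxf⟩
    exact ⟨hxf, hy⟩
  · rintro ⟨h, hg⟩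
    exact ⟨⟨⟨x, h⟩, hg, rfl⟩, h⟩

theorem compNat_apply (g f : H →ₗ.[ℂ] H) (x : H) (h : x ∈ f.domain) (hg : f ⟨x, h⟩ ∈ g.domain) :
    compNat g f ⟨x, (mem_compNat_domain g f x).2 ⟨h, hg⟩⟩ = g ⟨f ⟨x, h⟩, hg⟩ := rfl

/-- The operator `f` is densely defined and `S` is the everywhere defined bounded operator that
extends it. -/
def IsBoundedExtension (f : H →ₗ.[ℂ] H) (S : H →L[ℂ] H) : Prop :=
  Dense (f.domain : Set H) ∧ ∀ x : f.domain, f x = S x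

/-- There is at most one bounded extension. -/
theorem IsBoundedExtension.unique {f : H →ₗ.[ℂ] H} {S S' : H →L[ℂ] H}
    (h : IsBoundedExtension f S) (h' : IsBoundedExtension f S') : S = S' := by
  refine ContinuousLinearMap.coeFn_injective
    (Continuous.ext_on h.1 S.continuous S'.continuous fun x hx => ?_)
  rw [← h.2 ⟨x, hx⟩, ← h'.2 ⟨x, hx⟩]

end PartialOperators

/-- The Hilbert space `L²(ℝ)`. -/
abbrev L2 : Type := Lp ℂ 2 (volume : Measure ℝ)

theorem mul_add_ae (m : ℝ → ℝ) (φ ψ : L2) :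
    (fun p => (m p : ℂ) * (φ + ψ : L2) p) =ᵐ[volume]
      fun p => (m p : ℂ) * φ p + (m p : ℂ) * ψ p := by
  filter_upwards [Lp.coeFn_add φ ψ] with p hp
  rw [hp, Pi.add_apply, mul_add]

theorem mul_zero_ae (m : ℝ → ℝ) :
    (fun p => (m p : ℂ) * (0 : L2) p) =ᵐ[volume] fun _ => (0 : ℂ) := by
  filter_upwards [Lp.coeFn_zero ℂ 2 (volume : Measure ℝ)] with p hp
  rw [hp, Pi.zero_apply, mul_zero]

theorem mul_smul_ae (m : ℝ → ℝ) (c : ℂ) (φ : L2) :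
    (fun p => (m p : ℂ) * (c • φ : L2) p) =ᵐ[volume] c • fun p => (m p : ℂ) * φ p := by
  filter_upwards [Lp.coeFn_smul c φ] with p hp
  rw [hp, Pi.smul_apply, Pi.smul_apply, smul_eq_mul, smul_eq_mul, mul_left_comm]

/-- The domain `{φ ∈ L² | m φ ∈ L²}`. -/
def mulDomain (m : ℝ → ℝ) : Submodule ℂ L2 where
  carrier := {φ | MemLp (fun p => (m p : ℂ) * φ p) 2 volume}
  add_mem' {φ ψ} hφ hψ := (MemLp.add hφ hψ).ae_eq (mul_add_ae m φ ψ).symm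
  zero_mem' := (MemLp.zero (p := 2) (ε := ℂ)).ae_eq (mul_zero_ae m).symm
  smul_mem' c φ hφ := (MemLp.const_smul hφ c).ae_eq (mul_smul_ae m c φ).symm

/-- The maximal operator of multiplication by the real function `m` in `L²(ℝ)`, with domain
`{φ ∈ L² | m φ ∈ L²}`. -/
def mulOp (m : ℝ → ℝ) : L2 →ₗ.[ℂ] L2 where
  domain := mulDomain m
  toFun :=
    { toFun := fun φ => MemLp.toLp (fun p => (m p : ℂ) * φ.1 p) φ.2
      map_add' := by
        intro φ ψ
        have h₁ : MemLp (fun p => (m p : ℂ) * φ.1 p) 2 volume := φ.2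
        have h₂ : MemLp (fun p => (m p : ℂ) * ψ.1 p) 2 volume := ψ.2
        have h : MemLp (fun p => (m p : ℂ) * (φ.1 + ψ.1 : L2) p) 2 volume := (φ + ψ).2
        have e : h.toLp _ = h₁.toLp _ + h₂.toLp _ :=
          (MemLp.toLp_congr h (h₁.add h₂) (mul_add_ae m φ.1 ψ.1)).trans (MemLp.toLp_add h₁ h₂)
        exact e
      map_smul' := by
        intro c φ
        have h : MemLp (fun p => (m p : ℂ) * φ.1 p) 2 volume := φ.2
        have h' : MemLp (fun p => (m p : ℂ) * (c • φ.1 : L2) p) 2 volume := (c • φ).2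
        have e : h'.toLp _ = c • h.toLp _ :=
          (MemLp.toLp_congr h' (h.const_smul c) (mul_smul_ae m c φ.1)).trans
            (MemLp.toLp_const_smul c h)
        exact e }

theorem integral_add_ae (K : ℝ → ℝ → ℝ) (φ ψ : L2)
    (hφ : ∀ᵐ p : ℝ, Integrable (fun q => (K p q : ℂ) * φ q) volume)
    (hψ : ∀ᵐ p : ℝ, Integrable (fun q => (K p q : ℂ) * ψ q) volume) :
    (fun p => ∫ q, (K p q : ℂ) * (φ + ψ : L2) q) =ᵐ[volume]
      (fun p => ∫ q, (K p q : ℂ) * φ q) + fun p => ∫ q, (K p q : ℂ) * ψ q := by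
  filter_upwards [hφ, hψ] with p h1 h2
  rw [integral_congr_ae (mul_add_ae (K p) φ ψ), integral_add h1 h2, Pi.add_apply]

theorem integral_zero_ae (K : ℝ → ℝ → ℝ) :
    (fun p => ∫ q, (K p q : ℂ) * (0 : L2) q) =ᵐ[volume] fun _ => (0 : ℂ) := by
  refine Filter.Eventually.of_forall fun p => ?_
  simp only [integral_congr_ae (mul_zero_ae (K p)), integral_zero]

theorem integral_smul_ae (K : ℝ → ℝ → ℝ) (c : ℂ) (φ : L2) :
    (fun p => ∫ q, (K p q : ℂ) * (c • φ : L2) q) =ᵐ[volume]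
      c • fun p => ∫ q, (K p q : ℂ) * φ q := by
  refine Filter.Eventually.of_forall fun p => ?_
  simp only [integral_congr_ae (mul_smul_ae (K p) c φ), Pi.smul_apply, integral_smul]

/-- The `φ ∈ L²` for which `∫ K(p, q) φ(q) dq` converges absolutely for almost every `p` and is
square integrable in `p`. -/
def kernelDomain (K : ℝ → ℝ → ℝ) : Submodule ℂ L2 where
  carrier := {φ | (∀ᵐ p : ℝ, Integrable (fun q => (K p q : ℂ) * φ q) volume) ∧
    MemLp (fun p => ∫ q, (K p q : ℂ) * φ q) 2 volume}
  add_mem' {φ ψ} hφ hψ := by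
    refine ⟨?_, (hφ.2.add hψ.2).ae_eq (integral_add_ae K φ ψ hφ.1 hψ.1).symm⟩
    filter_upwards [hφ.1, hψ.1] with p h1 h2
    exact (h1.add h2).congr (mul_add_ae (K p) φ ψ).symm
  zero_mem' :=
    ⟨Filter.Eventually.of_forall fun p => (integrable_zero _ _ _).congr (mul_zero_ae (K p)).symm,
      (MemLp.zero (p := 2) (ε := ℂ)).ae_eq (integral_zero_ae K).symm⟩
  smul_mem' c φ hφ := by
    refine ⟨?_, (hφ.2.const_smul c).ae_eq (integral_smul_ae K c φ).symm⟩
    filter_upwards [hφ.1] with p h1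
    exact (h1.smul c).congr (mul_smul_ae (K p) c φ).symm

/-- The maximal integral operator `(K φ)(p) = ∫ K(p, q) φ(q) dq` in `L²(ℝ)`. -/
def kernelOp (K : ℝ → ℝ → ℝ) : L2 →ₗ.[ℂ] L2 where
  domain := kernelDomain K
  toFun :=
    { toFun := fun φ => MemLp.toLp (fun p => ∫ q, (K p q : ℂ) * φ.1 q) φ.2.2
      map_add' := by
        intro φ ψ
        have h₁ : MemLp (fun p => ∫ q, (K p q : ℂ) * φ.1 q) 2 volume := φ.2.2
        have h₂ : MemLp (fun p => ∫ q, (K p q : ℂ) * ψ.1 q) 2 volume := ψ.2.2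
        have h : MemLp (fun p => ∫ q, (K p q : ℂ) * (φ.1 + ψ.1 : L2) q) 2 volume := (φ + ψ).2.2
        have e : h.toLp _ = h₁.toLp _ + h₂.toLp _ :=
          (MemLp.toLp_congr h (h₁.add h₂) (integral_add_ae K φ.1 ψ.1 φ.2.1 ψ.2.1)).trans
            (MemLp.toLp_add h₁ h₂)
        exact e
      map_smul' := by
        intro c φ
        have h : MemLp (fun p => ∫ q, (K p q : ℂ) * φ.1 q) 2 volume := φ.2.2
        have h' : MemLp (fun p => ∫ q, (K p q : ℂ) * (c • φ.1 : L2) q) 2 volume := (c • φ).2.2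
        have e : h'.toLp _ = c • h.toLp _ :=
          (MemLp.toLp_congr h' (h.const_smul c) (integral_smul_ae K c φ.1)).trans
            (MemLp.toLp_const_smul c h)
        exact e }

/-- The parity operator `(Π φ)(s) = φ(-s)`. -/
def parity : L2 →ₗ[ℂ] L2 :=
  Lp.compMeasurePreservingₗ ℂ (fun s : ℝ => -s) (Measure.measurePreserving_neg volume)

/-- The integral kernel of `T̂_θ`. -/
def hatTKernel (θ t s : ℝ) : ℝ :=
  1 / (2 * Real.pi * |Real.sin θ|) *
    (1 / ((t ^ 2 - 2 * Real.cos θ * t * s + s ^ 2) / (2 * Real.sin θ ^ 2) + 1))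

/-- The operator `T̂_θ` in the Fourier representation. -/
def hatT (θ : ℝ) : L2 →ₗ.[ℂ] L2 := kernelOp (hatTKernel θ)

/-- The odd part `T̂_θ⁻ = (1 - Π)/2 T̂_θ`. -/
def hatTMinus (θ : ℝ) : L2 →ₗ.[ℂ] L2 :=
  ((1 / 2 : ℂ) • (LinearMap.id - parity)).compPMap (hatT θ)

/-- The function of which `T̂_0` is the multiplication operator. -/
def hatTZero (s : ℝ) : ℝ := 1 / Real.sqrt (s ^ 2 + 2)

/-- The unbounded operator `(2^{-1/2} - T̂_0)^{-1/2}`, the multiplication by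
`(2^{-1/2} - 1/√(p² + 2))^{-1/2}` on its maximal domain. -/
def weight : L2 →ₗ.[ℂ] L2 :=
  mulOp fun p => ((2 : ℝ) ^ (-1 / 2 : ℝ) - hatTZero p) ^ (-1 / 2 : ℝ)

/-- The product `(2^{-1/2} - T̂_0)^{-1/2} T̂_θ⁻ (2^{-1/2} - T̂_0)^{-1/2}` on its natural domain. -/
def sandwich (θ : ℝ) : L2 →ₗ.[ℂ] L2 :=
  compNat weight (compNat (hatTMinus θ) weight)

end Scissor

end

/-! Put `c = cos θ`. The sandwiched operator has the kernel `w(t) w(q) k(t, q)`, where `w` is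
`weightFun` and `k` is `oddKernel c`, a multiple of `1/(A - x) - 1/(A + x)` with `A = t² + q² + 2(1
- c²)` and `x = 2ctq`. This difference equals `2 ∫₀^∞ exp(-Au) sinh(xu) du`. Expanding `sinh` in its
power series gives a sum over `k` and an integral over `u` of products of one function of `t` and
the same function of `q`, with coefficients that are nonnegative when `c ≥ 0`
(`lintegral_feature_mul`, `integral_feature_mul`). So for `0 ≤ c < 1` the operator is `A* A` for a
Hilbert–Schmidt operator `A` from `L²(ℝ)` to `L²(ℕ × (0, ∞))`. It is positive, and its trace norm is
at most the squared Hilbert–Schmidt norm of `A`, which is the integral of the diagonal `w(t)² k(t,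
t)`.

On the diagonal, `√(t² + 2) ≤ √2 + |t|` bounds this integrand by a rational function of `|t|` with
an elementary antiderivative, whence `diagBound c`. In half angles, `diagBound (cos θ)` is the
asserted bound with a nonnegative term left out (`diagBound_cos_le`).

Since `k` is odd in `c`, replacing `θ` by `π - θ` only changes the sign of the operator, hence not
its trace norm. The unsandwiched operator is itself Hilbert–Schmidt, so the only domain condition is
membership in the dense domain of `weight` (`isBoundedExtension_sandwich`). -/

noncomputable section

namespace Scissor

/-! ### Hilbert–Schmidt integral operators between L² spaces. -/

section HilbertSchmidt

variable {X Y : Type*} [MeasurableSpace X] [MeasurableSpace Y]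
  {μ : Measure X} {ν : Measure Y}

/-- `a` is a square integrable kernel. -/
def IsHSKernel (a : X → Y → ℝ) (μ : Measure X) (ν : Measure Y) : Prop :=
  MemLp (fun z : X × Y => (a z.1 z.2 : ℂ)) 2 (μ.prod ν)

variable {a : X → Y → ℝ}

theorem IsHSKernel.integrable_sq (h : IsHSKernel a μ ν) :
    Integrable (fun z : X × Y => a z.1 z.2 ^ 2) (μ.prod ν) := by
  have := (memLp_two_iff_integrable_sq_norm h.1).1 h
  simpa using this

theorem inner_toLp_ofReal {b : Y → ℝ} (hb : MemLp (fun y => (b y : ℂ)) 2 ν)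
    (φ : Lp ℂ 2 ν) : ⟪hb.toLp _, φ⟫_ℂ = ∫ y, (b y : ℂ) * φ y ∂ν := by
  rw [L2.inner_def]
  refine integral_congr_ae ?_
  filter_upwards [hb.coeFn_toLp] with y hy
  rw [hy, RCLike.inner_apply, Complex.conj_ofReal, mul_comm]

theorem norm_sq_eq_integral (φ : Lp ℂ 2 ν) : ‖φ‖ ^ 2 = ∫ y, ‖φ y‖ ^ 2 ∂ν := by
  have h := inner_self_eq_norm_sq (𝕜 := ℂ) φ
  rw [L2.inner_def, ← integral_re (L2.integrable_inner φ φ)] at h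
  rw [← h]
  exact integral_congr_ae (Filter.Eventually.of_forall fun y =>
    inner_self_eq_norm_sq (𝕜 := ℂ) (φ y))

theorem norm_toLp_ofReal_sq {b : Y → ℝ} (hb : MemLp (fun y => (b y : ℂ)) 2 ν) :
    ‖hb.toLp _‖ ^ 2 = ∫ y, b y ^ 2 ∂ν := by
  rw [norm_sq_eq_integral]
  refine integral_congr_ae ?_
  filter_upwards [hb.coeFn_toLp] with y hy
  rw [hy]; simp

variable [SigmaFinite ν]

theorem IsHSKernel.integrable_integral_sq (h : IsHSKernel a μ ν) :
    Integrable (fun x => ∫ y, a x y ^ 2 ∂ν) μ :=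
  h.integrable_sq.integral_prod_left

variable [SigmaFinite μ]

theorem IsHSKernel.swap (h : IsHSKernel a μ ν) : IsHSKernel (fun y x => a x y) ν μ :=
  MemLp.comp_measurePreserving h Measure.measurePreserving_swap

theorem IsHSKernel.ae_memLp (h : IsHSKernel a μ ν) :
    ∀ᵐ x ∂μ, MemLp (fun y => (a x y : ℂ)) 2 ν := by
  filter_upwards [h.integrable_sq.prod_right_ae, h.1.prodMk_left] with x hx hm
  refine (memLp_two_iff_integrable_sq_norm hm).2 ?_
  simpa using hx

theorem IsHSKernel.ae_integrable_mul (h : IsHSKernel a μ ν) {f : Y → ℂ} (hf : MemLp f 2 ν) :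
    ∀ᵐ x ∂μ, Integrable (fun y => (a x y : ℂ) * f y) ν := by
  filter_upwards [h.ae_memLp] with x hx
  exact hx.integrable_mul hf

/-- Cauchy–Schwarz applied to the row `a x ·`, which is square integrable for almost every `x`. -/
theorem IsHSKernel.ae_norm_integral_sq_le (h : IsHSKernel a μ ν) (φ : Lp ℂ 2 ν) :
    ∀ᵐ x ∂μ, ‖∫ y, (a x y : ℂ) * φ y ∂ν‖ ^ 2 ≤ (∫ y, a x y ^ 2 ∂ν) * ‖φ‖ ^ 2 := by
  filter_upwards [h.ae_memLp] with x hx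
  rw [← inner_toLp_ofReal hx, ← norm_toLp_ofReal_sq hx, ← mul_pow]
  exact pow_le_pow_left₀ (norm_nonneg _) (norm_inner_le_norm _ _) 2

theorem IsHSKernel.memLp_integral (h : IsHSKernel a μ ν) (φ : Lp ℂ 2 ν) :
    MemLp (fun x => ∫ y, (a x y : ℂ) * φ y ∂ν) 2 μ := by
  have hm : AEStronglyMeasurable (fun x => ∫ y, (a x y : ℂ) * φ y ∂ν) μ :=
    (h.1.mul (Lp.aestronglyMeasurable φ).comp_snd).integral_prod_right'
  refine (memLp_two_iff_integrable_sq_norm hm).2 ?_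
  refine (h.integrable_integral_sq.mul_const (‖φ‖ ^ 2)).mono' (hm.norm.pow 2) ?_
  filter_upwards [h.ae_norm_integral_sq_le φ] with x hx
  rwa [Real.norm_of_nonneg (by positivity)]

/-- The Hilbert–Schmidt operator with kernel `a`. -/
def IsHSKernel.op (h : IsHSKernel a μ ν) : Lp ℂ 2 ν →L[ℂ] Lp ℂ 2 μ :=
  LinearMap.mkContinuous
    { toFun := fun φ => (h.memLp_integral φ).toLp _
      map_add' := by
        intro φ ψ
        rw [← MemLp.toLp_add]
        refine MemLp.toLp_congr _ _ ?_
        filter_upwards [h.ae_integrable_mul (Lp.memLp φ), h.ae_integrable_mul (Lp.memLp ψ)]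
          with x h1 h2
        rw [Pi.add_apply, ← integral_add h1 h2]
        refine integral_congr_ae ?_
        filter_upwards [Lp.coeFn_add φ ψ] with y hy
        rw [hy, Pi.add_apply, mul_add]
      map_smul' := by
        intro c φ
        rw [RingHom.id_apply, ← MemLp.toLp_const_smul]
        refine MemLp.toLp_congr _ _ (Filter.Eventually.of_forall fun x => ?_)
        simp only [Pi.smul_apply, ← integral_smul]
        refine integral_congr_ae ?_
        filter_upwards [Lp.coeFn_smul c φ] with y hy
        rw [hy, Pi.smul_apply, smul_eq_mul, smul_eq_mul, mul_left_comm] }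
    (Real.sqrt (∫ x, ∫ y, a x y ^ 2 ∂ν ∂μ)) (by
      intro φ
      refine le_of_sq_le_sq ?_ (by positivity)
      rw [mul_pow, Real.sq_sqrt (integral_nonneg fun x => integral_nonneg fun y => sq_nonneg _),
        norm_sq_eq_integral, ← integral_mul_const]
      refine integral_mono_of_nonneg (Filter.Eventually.of_forall fun x => by positivity)
        (h.integrable_integral_sq.mul_const _) ?_
      filter_upwards [(h.memLp_integral φ).coeFn_toLp, h.ae_norm_integral_sq_le φ] with x hx hx'
      simp only [LinearMap.coe_mk, AddHom.coe_mk]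
      rwa [hx])

theorem IsHSKernel.op_apply_ae (h : IsHSKernel a μ ν) (φ : Lp ℂ 2 ν) :
    h.op φ =ᵐ[μ] fun x => ∫ y, (a x y : ℂ) * φ y ∂ν :=
  (h.memLp_integral φ).coeFn_toLp

theorem IsHSKernel.integral_integral_swap (h : IsHSKernel a μ ν) {f : X → ℂ} {g : Y → ℂ}
    (hf : MemLp f 2 μ) (hg : MemLp g 2 ν) :
    ∫ x, f x * ∫ y, (a x y : ℂ) * g y ∂ν ∂μ = ∫ y, (∫ x, (a x y : ℂ) * f x ∂μ) * g y ∂ν := by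
  have hfg : MemLp (fun z : X × Y => f z.1 * g z.2) 2 (μ.prod ν) := by
    refine (memLp_two_iff_integrable_sq_norm (hf.1.comp_fst.mul hg.1.comp_snd)).2 ?_
    have := ((memLp_two_iff_integrable_sq_norm hf.1).1 hf).mul_prod
      ((memLp_two_iff_integrable_sq_norm hg.1).1 hg)
    refine this.congr (Filter.Eventually.of_forall fun z => ?_)
    simp [mul_pow]
  have hi : Integrable (Function.uncurry fun x y => (a x y : ℂ) * (f x * g y)) (μ.prod ν) :=
    MemLp.integrable_mul h hfg
  calc _ = ∫ x, ∫ y, (a x y : ℂ) * (f x * g y) ∂ν ∂μ := by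
        refine integral_congr_ae (Filter.Eventually.of_forall fun x => ?_)
        simp only [← integral_const_mul]
        exact integral_congr_ae (Filter.Eventually.of_forall fun y => by simp only; ring)
    _ = ∫ y, ∫ x, (a x y : ℂ) * (f x * g y) ∂μ ∂ν := MeasureTheory.integral_integral_swap hi
    _ = _ := by
        refine integral_congr_ae (Filter.Eventually.of_forall fun y => ?_)
        simp only [← integral_mul_const]
        exact integral_congr_ae (Filter.Eventually.of_forall fun x => by simp only; ring)

theorem IsHSKernel.adjoint_op (h : IsHSKernel a μ ν) :
    ContinuousLinearMap.adjoint h.op = h.swap.op := by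
  symm
  rw [ContinuousLinearMap.eq_adjoint_iff]
  intro ψ φ
  have hs : MemLp (fun x => (starRingEnd ℂ) (ψ x)) 2 μ := (Lp.memLp ψ).star
  have key := h.integral_integral_swap hs (Lp.memLp φ)
  rw [L2.inner_def, L2.inner_def]
  refine Eq.trans (integral_congr_ae ?_) (key.symm.trans (integral_congr_ae ?_))
  · filter_upwards [h.swap.op_apply_ae ψ] with y hy
    rw [hy, RCLike.inner_apply, mul_comm, ← integral_conj]
    simp
  · filter_upwards [h.op_apply_ae φ] with x hx
    rw [hx, RCLike.inner_apply, mul_comm]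

/-- The operator with kernel `∫ a(x, t) a(x, q) dx`. -/
theorem IsHSKernel.adjoint_op_op_ae (h : IsHSKernel a μ ν) (φ : Lp ℂ 2 ν) :
    (ContinuousLinearMap.adjoint h.op ∘L h.op) φ =ᵐ[ν] fun t =>
      ∫ q, ((∫ x, a x q * a x t ∂μ : ℝ) : ℂ) * φ q ∂ν := by
  rw [ContinuousLinearMap.comp_apply, h.adjoint_op]
  filter_upwards [h.swap.op_apply_ae (h.op φ), h.swap.ae_memLp] with t ht hm
  rw [ht]
  refine Eq.trans (integral_congr_ae ?_) ((h.integral_integral_swap hm (Lp.memLp φ)).trans ?_)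
  · filter_upwards [h.op_apply_ae φ] with x hx
    rw [hx]
  · refine integral_congr_ae (Filter.Eventually.of_forall fun q => ?_)
    simp only [← integral_complex_ofReal, Complex.ofReal_mul]

/-- Since `a` is real, `h.op (b i) x` has the modulus of the coefficient of the row `a x ·` along `b
i`. Bessel's inequality holds for almost every row and is then integrated over `x`. -/
theorem IsHSKernel.sum_norm_sq_le (h : IsHSKernel a μ ν) {ι : Type*} {b : ι → Lp ℂ 2 ν}
    (hb : Orthonormal ℂ b) (s : Finset ι) :
    ∑ i ∈ s, ‖h.op (b i)‖ ^ 2 ≤ ∫ x, ∫ y, a x y ^ 2 ∂ν ∂μ := by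
  have hi : ∀ i ∈ s, Integrable (fun x => ‖h.op (b i) x‖ ^ 2) μ := fun i _ =>
    (memLp_two_iff_integrable_sq_norm (Lp.memLp _).1).1 (Lp.memLp _)
  simp only [norm_sq_eq_integral]
  rw [← integral_finsetSum s hi]
  refine integral_mono_ae (integrable_finsetSum s hi) h.integrable_integral_sq ?_
  have hall : ∀ᵐ x ∂μ, ∀ i ∈ s, h.op (b i) x = ∫ y, (a x y : ℂ) * b i y ∂ν :=
    (Finset.eventually_all s).2 fun i _ => h.op_apply_ae (b i)
  filter_upwards [hall, h.ae_memLp] with x hx hm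
  rw [← norm_toLp_ofReal_sq hm]
  refine le_trans (le_of_eq ?_) (hb.sum_inner_products_le (s := s) (hm.toLp _))
  refine Finset.sum_congr rfl fun i hi => ?_
  rw [hx i hi, ← inner_toLp_ofReal hm, norm_inner_symm]

end HilbertSchmidt

/-! ### Trace norm of an operator of the form `A* A`. -/

section TraceNorm

variable {H K : Type*} [NormedAddCommGroup H] [InnerProductSpace ℂ H] [CompleteSpace H]
  [NormedAddCommGroup K] [InnerProductSpace ℂ K] [CompleteSpace K]

theorem traceNorm_neg (S : H →L[ℂ] H) : traceNorm (-S) = traceNorm S := by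
  simp only [traceNorm, CFC.abs_neg]

/-- A positive operator is its own absolute value, so the diagonal sum in any orthonormal basis is
`∑ ‖A (b i)‖²`. It suffices to bound the finite partial sums uniformly in the basis. -/
theorem traceNorm_adjoint_mul_self_le (A : H →L[ℂ] K) {B : ℝ}
    (hB : ∀ (w : Set H) (b : HilbertBasis w ℂ H) (s : Finset w), ∑ i ∈ s, ‖A (b i)‖ ^ 2 ≤ B) :
    traceNorm (ContinuousLinearMap.adjoint A ∘L A) ≤ ENNReal.ofReal B := by
  have hpos : 0 ≤ ContinuousLinearMap.adjoint A ∘L A :=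
    (ContinuousLinearMap.nonneg_iff_isPositive _).2
      (ContinuousLinearMap.isPositive_adjoint_comp_self A)
  refine iSup_le fun w => iSup_le fun b => ?_
  rw [CFC.abs_of_nonneg _ hpos, ENNReal.tsum_eq_iSup_sum]
  refine iSup_le fun s => ?_
  have he : ∀ i : w, RCLike.re ⟪b i, (ContinuousLinearMap.adjoint A ∘L A) (b i)⟫_ℂ
      = ‖A (b i)‖ ^ 2 := fun i => by
    rw [ContinuousLinearMap.comp_apply, ContinuousLinearMap.adjoint_inner_right,
      inner_self_eq_norm_sq]
  simp only [he]
  rw [← ENNReal.ofReal_sum_of_nonneg fun i _ => by positivity]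
  exact ENNReal.ofReal_le_ofReal (hB w b s)

end TraceNorm

/-! ### Explicit integration of the diagonal majorant. -/

section Diagonal

theorem integrable_comp_abs {f : ℝ → ℝ} (hf : IntegrableOn f (Ioi 0)) :
    Integrable fun t : ℝ => f |t| := by
  have h1 : IntegrableOn (fun t : ℝ => f |t|) (Ioi 0) :=
    hf.congr_fun (fun t ht => by simp only [abs_of_pos (mem_Ioi.1 ht)]) measurableSet_Ioi
  have h2 : IntegrableOn (fun t : ℝ => f |t|) (Iic 0) := by
    have hm : MeasurableEmbedding fun t : ℝ => -t := (Homeomorph.neg ℝ).measurableEmbedding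
    rw [← Measure.map_neg_eq_self (volume : Measure ℝ), hm.integrableOn_map_iff]
    simpa [Function.comp_def, integrableOn_Ici_iff_integrableOn_Ioi] using h1
  rw [← integrableOn_univ, ← Iic_union_Ioi (a := (0 : ℝ))]
  exact h2.union h1

/-- An integrable majorant on `t ≥ 0` of the diagonal of the kernel of the sandwich operator. -/
def diagMajorant (c t : ℝ) : ℝ :=
  1 / (2 * Real.pi * Real.sqrt (1 - c ^ 2)) *
    (c * (Real.sqrt 2 * (t ^ 2 + 4) + 2 * t) / ((t ^ 2 + (1 - c)) * (t ^ 2 + (1 + c))))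

/-- An antiderivative of `diagMajorant`. -/
def diagPrimitive (c t : ℝ) : ℝ :=
  1 / (2 * Real.pi * Real.sqrt (1 - c ^ 2)) *
    (Real.sqrt 2 / 2 * (Real.sqrt (1 + c) * Real.arctan (t / Real.sqrt (1 + c))
        - Real.sqrt (1 - c) * Real.arctan (t / Real.sqrt (1 - c)))
      + 2 * Real.sqrt 2 * (Real.arctan (t / Real.sqrt (1 - c)) / Real.sqrt (1 - c)
        - Real.arctan (t / Real.sqrt (1 + c)) / Real.sqrt (1 + c))
      + 1 / 2 * Real.log ((t ^ 2 + (1 - c)) / (t ^ 2 + (1 + c))))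

/-- The integral of the majorant over the line. -/
def diagBound (c : ℝ) : ℝ :=
  Real.artanh c / (Real.pi * Real.sqrt (1 - c ^ 2)) +
    (Real.sqrt (1 + c) - Real.sqrt (1 - c)) * (Real.sqrt (1 - c ^ 2) + 4) /
      (2 * Real.sqrt 2 * Real.sqrt (1 - c ^ 2) ^ 2)

variable {c : ℝ}

theorem sqrt_one_sub_sq (hc0 : 0 ≤ c) :
    Real.sqrt (1 - c ^ 2) = Real.sqrt (1 + c) * Real.sqrt (1 - c) := by
  rw [← Real.sqrt_mul (by linarith)]
  congr 1
  ring

theorem hasDerivAt_arctan_div_sqrt {a : ℝ} (ha : 0 < a) (t : ℝ) :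
    HasDerivAt (fun t => Real.arctan (t / Real.sqrt a)) (Real.sqrt a / (t ^ 2 + a)) t := by
  have hs : 0 < Real.sqrt a := Real.sqrt_pos.2 ha
  have h := ((hasDerivAt_id t).div_const (Real.sqrt a)).arctan
  convert! h using 1
  have h2 := Real.sq_sqrt ha.le
  simp only [id]
  rw [div_pow, h2]
  have : 0 < t ^ 2 + a := by positivity
  have : 0 < a + t ^ 2 := by positivity
  field_simp
  rw [h2]
  ring

/-- With `a = 1 - c` and `b = 1 + c`, so that `b - a = 2c`, this is the partial fraction
decomposition over `t² + a` and `t² + b`. The terms in `t²` and `4` give the two groups of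
arctangents, and the term in `2t` gives the logarithm. -/
theorem hasDerivAt_diagPrimitive (hc0 : 0 ≤ c) (hc1 : c < 1) (t : ℝ) :
    HasDerivAt (diagPrimitive c) (diagMajorant c t) t := by
  have ha : 0 < 1 - c := by linarith
  have hb : 0 < 1 + c := by linarith
  have h1 := hasDerivAt_arctan_div_sqrt ha t
  have h2 := hasDerivAt_arctan_div_sqrt hb t
  have ha' : 0 < t ^ 2 + (1 - c) := by positivity
  have hb' : 0 < t ^ 2 + (1 + c) := by positivity
  have hsq : HasDerivAt (fun t : ℝ => t ^ 2) (2 * t) t := by simpa using hasDerivAt_pow 2 t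
  have h3 := ((hsq.add_const (1 - c)).div (hsq.add_const (1 + c)) hb'.ne').log
    (div_pos ha' hb').ne'
  have h := ((((h2.const_mul (Real.sqrt (1 + c))).sub
    (h1.const_mul (Real.sqrt (1 - c)))).const_mul (Real.sqrt 2 / 2)).add
    (((h1.div_const (Real.sqrt (1 - c))).sub (h2.div_const (Real.sqrt (1 + c)))).const_mul
      (2 * Real.sqrt 2))).add (h3.const_mul (1 / 2))
  refine (h.const_mul (1 / (2 * Real.pi * Real.sqrt (1 - c ^ 2)))).congr_deriv ?_
  rw [diagMajorant]
  congr 1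
  have e1 := Real.mul_self_sqrt ha.le
  have e2 := Real.mul_self_sqrt hb.le
  have p1 : 0 < Real.sqrt (1 - c) := Real.sqrt_pos.2 ha
  have p2 : 0 < Real.sqrt (1 + c) := Real.sqrt_pos.2 hb
  rw [← mul_div_assoc, e2, ← mul_div_assoc, e1, div_div, mul_comm _ (Real.sqrt (1 - c)),
    div_mul_cancel_left₀ p1.ne', div_div, mul_comm _ (Real.sqrt (1 + c)),
    div_mul_cancel_left₀ p2.ne']
  simp only [Pi.div_apply]
  field_simp
  ring

theorem diagMajorant_nonneg (hc0 : 0 ≤ c) (hc1 : c < 1) {t : ℝ} (ht : 0 ≤ t) :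
    0 ≤ diagMajorant c t := by
  have ha : 0 < 1 - c := by linarith
  unfold diagMajorant
  positivity

/-- The arctangents vanish at `0`, so this endpoint alone produces the `artanh` term of the bound.
-/
theorem diagPrimitive_zero (hc0 : 0 ≤ c) (hc1 : c < 1) :
    diagPrimitive c 0 = -(Real.artanh c / (2 * Real.pi * Real.sqrt (1 - c ^ 2))) := by
  rw [Real.artanh_eq_half_log ⟨by linarith, hc1.le⟩, diagPrimitive]
  have : Real.log ((1 - c) / (1 + c)) = - Real.log ((1 + c) / (1 - c)) := by
    rw [← Real.log_inv, inv_div]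
  simp [this]
  ring

theorem tendsto_diagPrimitive (hc0 : 0 ≤ c) (hc1 : c < 1) :
    Filter.Tendsto (diagPrimitive c) Filter.atTop (nhds
      (1 / (2 * Real.pi * Real.sqrt (1 - c ^ 2)) *
    (Real.sqrt 2 / 2 * (Real.sqrt (1 + c) * (Real.pi / 2) - Real.sqrt (1 - c) * (Real.pi / 2))
      + 2 * Real.sqrt 2 * ((Real.pi / 2) / Real.sqrt (1 - c) - (Real.pi / 2) / Real.sqrt (1 + c))
      + 1 / 2 * Real.log 1))) := by
  have ha : 0 < 1 - c := by linarith
  have hb : 0 < 1 + c := by linarith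
  have hat : ∀ a : ℝ, 0 < a → Filter.Tendsto (fun t => Real.arctan (t / Real.sqrt a))
      Filter.atTop (nhds (Real.pi / 2)) := fun a ha =>
    (Real.tendsto_arctan_atTop.mono_right nhdsWithin_le_nhds).comp
      (Filter.tendsto_id.atTop_div_const (Real.sqrt_pos.2 ha))
  have hlog : Filter.Tendsto (fun t : ℝ => (t ^ 2 + (1 - c)) / (t ^ 2 + (1 + c)))
      Filter.atTop (nhds 1) := by
    have h1 : Filter.Tendsto (fun t : ℝ => 1 - 2 * c / (t ^ 2 + (1 + c))) Filter.atTop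
        (nhds (1 - 0)) :=
      (Filter.Tendsto.const_div_atTop (Filter.tendsto_atTop_add_const_right _ _
        (Filter.tendsto_pow_atTop two_ne_zero)) _).const_sub 1
    rw [sub_zero] at h1
    refine h1.congr fun t => ?_
    have : 0 < t ^ 2 + (1 + c) := by positivity
    field_simp
    ring
  have h1 := hat _ ha
  have h2 := hat _ hb
  exact (((((h2.const_mul _).sub (h1.const_mul _)).const_mul _).add
    (((h1.div_const _).sub (h2.div_const _)).const_mul _)).add
    ((hlog.log one_ne_zero).const_mul _)).const_mul _

theorem lintegral_diagMajorant_abs (hc0 : 0 ≤ c) (hc1 : c < 1) :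
    ∫⁻ t : ℝ, ENNReal.ofReal (diagMajorant c |t|) = ENNReal.ofReal (diagBound c) := by
  have ha : 0 < 1 - c := by linarith
  have hb : 0 < 1 + c := by linarith
  have hcont := (hasDerivAt_diagPrimitive hc0 hc1 0).continuousAt.continuousWithinAt (s := Ici 0)
  have hd : ∀ t ∈ Ioi (0 : ℝ), HasDerivAt (diagPrimitive c) (diagMajorant c t) t :=
    fun t _ => hasDerivAt_diagPrimitive hc0 hc1 t
  have hn : ∀ t ∈ Ioi (0 : ℝ), 0 ≤ diagMajorant c t := fun t ht =>
    diagMajorant_nonneg hc0 hc1 (le_of_lt ht)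
  have hint := integrableOn_Ioi_deriv_of_nonneg hcont hd hn (tendsto_diagPrimitive hc0 hc1)
  have hval := integral_Ioi_of_hasDerivAt_of_nonneg hcont hd hn (tendsto_diagPrimitive hc0 hc1)
  rw [← ofReal_integral_eq_lintegral_ofReal (integrable_comp_abs hint)
    (Filter.Eventually.of_forall fun t => diagMajorant_nonneg hc0 hc1 (abs_nonneg t)),
    integral_comp_abs, hval, diagPrimitive_zero hc0 hc1, diagBound, sqrt_one_sub_sq hc0]
  congr 1
  have p1 : 0 < Real.sqrt (1 - c) := Real.sqrt_pos.2 ha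
  have p2 : 0 < Real.sqrt (1 + c) := Real.sqrt_pos.2 hb
  have p3 : 0 < Real.sqrt 2 := by positivity
  have e3 : Real.sqrt 2 ^ 2 = 2 := Real.sq_sqrt (by norm_num)
  have := Real.pi_pos
  rw [Real.log_one]
  field_simp
  linear_combination Real.pi * (Real.sqrt (1 + c) - Real.sqrt (1 - c)) *
    (Real.sqrt (1 + c) * Real.sqrt (1 - c) + 4) * e3

end Diagonal

/-! ### The weight and its bounded inverse. -/

section Weight

/-- The function of which `weight` is the multiplication operator. -/
def weightFun (p : ℝ) : ℝ := ((2 : ℝ) ^ (-1 / 2 : ℝ) - hatTZero p) ^ (-1 / 2 : ℝ)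

theorem two_rpow_neg_half : (2 : ℝ) ^ (-1 / 2 : ℝ) = 1 / Real.sqrt 2 := by
  rw [Real.sqrt_eq_rpow, neg_div, Real.rpow_neg (by norm_num)]
  exact (one_div _).symm

theorem measurable_weightFun : Measurable weightFun := by
  unfold weightFun hatTZero
  fun_prop

theorem weightFun_neg (p : ℝ) : weightFun (-p) = weightFun p := by
  simp [weightFun, hatTZero]

theorem hatTZero_le (p : ℝ) : hatTZero p ≤ (2 : ℝ) ^ (-1 / 2 : ℝ) := by
  rw [two_rpow_neg_half, hatTZero]
  exact one_div_le_one_div_of_le (by positivity) (Real.sqrt_le_sqrt (by nlinarith [sq_nonneg p]))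

theorem hatTZero_lt {p : ℝ} (hp : p ≠ 0) : hatTZero p < (2 : ℝ) ^ (-1 / 2 : ℝ) := by
  rw [two_rpow_neg_half, hatTZero]
  have : 0 < p ^ 2 := by positivity
  exact one_div_lt_one_div_of_lt (by positivity) (Real.sqrt_lt_sqrt (by norm_num) (by linarith))

theorem weightFun_nonneg (p : ℝ) : 0 ≤ weightFun p :=
  Real.rpow_nonneg (sub_nonneg.2 (hatTZero_le p)) _

/-- Rationalization: with `r = √(p² + 2)`, the reciprocal of `1/√2 - 1/r` is `√2 r / (r - √2)`, and
`(r - √2)(r + √2) = p²`. -/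
theorem weightFun_sq {p : ℝ} (hp : p ≠ 0) : weightFun p ^ 2 =
    (Real.sqrt 2 * (p ^ 2 + 2) + 2 * Real.sqrt (p ^ 2 + 2)) / p ^ 2 := by
  have h := sub_pos.2 (hatTZero_lt hp)
  have hp2 : 0 < p ^ 2 := by positivity
  have he : (-1 / 2 : ℝ) * (2 : ℕ) = -1 := by norm_num
  rw [weightFun, ← Real.rpow_natCast, ← Real.rpow_mul h.le, he, Real.rpow_neg_one,
    two_rpow_neg_half]
  rw [two_rpow_neg_half, hatTZero] at h
  rw [hatTZero]
  have h2 : Real.sqrt 2 ^ 2 = 2 := Real.sq_sqrt (by norm_num)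
  have hr : Real.sqrt (p ^ 2 + 2) ^ 2 = p ^ 2 + 2 := Real.sq_sqrt (by positivity)
  have h2p : 0 < Real.sqrt 2 := by positivity
  have hrp : 0 < Real.sqrt (p ^ 2 + 2) := by positivity
  generalize Real.sqrt (p ^ 2 + 2) = r at *
  generalize Real.sqrt 2 = q at *
  rw [inv_eq_iff_eq_inv, inv_div, eq_div_iff (by positivity)]
  field_simp
  linear_combination (q * r - (r - q) * q) * hr - (q * r + (r - q) * r) * h2

/-- Replacing `√(p² + 2)` by `√2 + |p|` leaves a polynomial in `|p|`, which makes the diagonal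
majorant rational. -/
theorem weightFun_sq_mul_sq_le (p : ℝ) :
    weightFun p ^ 2 * p ^ 2 ≤ Real.sqrt 2 * (p ^ 2 + 4) + 2 * |p| := by
  rcases eq_or_ne p 0 with rfl | hp
  · simp
  · rw [weightFun_sq hp, div_mul_cancel₀ _ (by positivity)]
    have h : Real.sqrt (p ^ 2 + 2) ≤ Real.sqrt 2 + |p| := by
      rw [Real.sqrt_le_left (by positivity), add_sq, sq_abs, Real.sq_sqrt (by norm_num)]
      have : 0 ≤ 2 * Real.sqrt 2 * |p| := by positivity
      linarith
    linarith

/-- The bounded inverse of `weightFun`. -/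
def weightInv (p : ℝ) : ℝ := ((2 : ℝ) ^ (-1 / 2 : ℝ) - hatTZero p) ^ (1 / 2 : ℝ)

theorem measurable_weightInv : Measurable weightInv := by
  unfold weightInv hatTZero
  fun_prop

theorem weightInv_pos {p : ℝ} (hp : p ≠ 0) : 0 < weightInv p :=
  Real.rpow_pos_of_pos (sub_pos.2 (hatTZero_lt hp)) _

theorem weightInv_nonneg (p : ℝ) : 0 ≤ weightInv p :=
  Real.rpow_nonneg (sub_nonneg.2 (hatTZero_le p)) _

theorem weightFun_mul_weightInv {p : ℝ} (hp : p ≠ 0) : weightFun p * weightInv p = 1 := by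
  rw [weightFun, weightInv, ← Real.rpow_add (sub_pos.2 (hatTZero_lt hp))]
  norm_num

theorem weightInv_le_one (p : ℝ) : weightInv p ≤ 1 := by
  refine Real.rpow_le_one (sub_nonneg.2 (hatTZero_le p)) ?_ (by norm_num)
  have h1 : (2 : ℝ) ^ (-1 / 2 : ℝ) ≤ 1 :=
    Real.rpow_le_one_of_one_le_of_nonpos (by norm_num) (by norm_num)
  have h2 : 0 ≤ hatTZero p := by unfold hatTZero; positivity
  linarith

end Weight

/-! ### Factorization of the odd kernel through `sinh` and the trace bound for `c ≥ 0`. -/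

section Feature

/-- The odd part in `t` of the kernel of `T̂_θ`, where `c = cos θ`. -/
def oddKernel (c t q : ℝ) : ℝ :=
  Real.sqrt (1 - c ^ 2) / (2 * Real.pi) *
    (1 / (t ^ 2 + q ^ 2 + 2 * (1 - c ^ 2) - 2 * c * t * q)
      - 1 / (t ^ 2 + q ^ 2 + 2 * (1 - c ^ 2) + 2 * c * t * q))

/-- The functions `feature c x`, `x ∈ ℕ × (0, ∞)`, decompose the kernel of the sandwich operator
into products. -/
def feature (c : ℝ) (x : ℕ × ℝ) (t : ℝ) : ℝ :=
  Real.sqrt (Real.sqrt (1 - c ^ 2) / Real.pi *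
    ((2 * c * x.2) ^ (2 * x.1 + 1) / (2 * x.1 + 1).factorial) *
      Real.exp (-(2 * (1 - c ^ 2)) * x.2)) *
    (t ^ (2 * x.1 + 1) * Real.exp (-(t ^ 2 * x.2)) * weightFun t)

/-- The measure on the index set of the features. -/
def featureMeasure : Measure (ℕ × ℝ) := Measure.count.prod (volume.restrict (Ioi 0))

instance : SigmaFinite featureMeasure := by
  unfold featureMeasure; infer_instance

variable {c : ℝ}

theorem measurable_feature_fixed (c : ℝ) (k : ℕ) :
    Measurable fun z : ℝ × ℝ => feature c (k, z.1) z.2 := by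
  have h1 : Measurable fun z : ℝ × ℝ => weightFun z.2 := measurable_weightFun.comp measurable_snd
  have h2 : Measurable fun z : ℝ × ℝ => Real.sqrt (Real.sqrt (1 - c ^ 2) / Real.pi *
      ((2 * c * z.1) ^ (2 * k + 1) / (2 * k + 1).factorial) *
        Real.exp (-(2 * (1 - c ^ 2)) * z.1)) := by fun_prop
  have h3 : Measurable fun z : ℝ × ℝ => z.2 ^ (2 * k + 1) * Real.exp (-(z.2 ^ 2 * z.1)) := by
    fun_prop
  exact h2.mul (h3.mul h1)

theorem measurable_feature (c : ℝ) : Measurable fun z : (ℕ × ℝ) × ℝ => feature c z.1 z.2 := by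
  have h : Measurable fun z : ℕ × (ℝ × ℝ) => feature c (z.1, z.2.1) z.2.2 :=
    measurable_from_prod_countable_right (measurable_feature_fixed c)
  have := h.comp MeasurableEquiv.prodAssoc.measurable
  exact this

theorem measurable_feature_mul (c t q : ℝ) :
    Measurable fun x => feature c x q * feature c x t := by
  have h : ∀ r : ℝ, Measurable fun x : ℕ × ℝ => feature c x r := fun r => by
    have := (measurable_feature c).comp (measurable_id.prodMk (measurable_const (a := r)))
    exact this
  exact (h q).mul (h t)

theorem feature_neg (c : ℝ) (x : ℕ × ℝ) (t : ℝ) : feature c x (-t) = -feature c x t := by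
  rw [feature, feature, weightFun_neg, Odd.neg_pow ⟨x.1, rfl⟩, neg_sq]
  ring

theorem oddKernel_neg (c t q : ℝ) : oddKernel c (-t) q = -oddKernel c t q := by
  unfold oddKernel
  ring

theorem oddKernel_denom_pos (hc : c ^ 2 < 1) (t q : ℝ) :
    0 < t ^ 2 + q ^ 2 + 2 * (1 - c ^ 2) - 2 * c * t * q := by
  nlinarith [sq_nonneg (t - c * q), mul_nonneg (sub_nonneg.2 hc.le) (sq_nonneg q)]

/-- The last factor is the `k`-th term of the series of `sinh (2ctqu)`. The coefficient is split
evenly as a square root between the two features; `c ≥ 0` makes it nonnegative. -/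
theorem feature_mul_feature (hc0 : 0 ≤ c) (k : ℕ) {u : ℝ} (hu : 0 < u) (t q : ℝ) :
    feature c (k, u) q * feature c (k, u) t =
      Real.sqrt (1 - c ^ 2) / Real.pi * weightFun q * weightFun t *
        Real.exp (-(t ^ 2 + q ^ 2 + 2 * (1 - c ^ 2)) * u) *
          ((2 * c * (t * q) * u) ^ (2 * k + 1) / (2 * k + 1).factorial) := by
  have hM : 0 ≤ Real.sqrt (1 - c ^ 2) / Real.pi *
      ((2 * c * u) ^ (2 * k + 1) / (2 * k + 1).factorial) *
        Real.exp (-(2 * (1 - c ^ 2)) * u) := by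
    have := Real.pi_pos
    positivity
  have hE : Real.exp (-(t ^ 2 + q ^ 2 + 2 * (1 - c ^ 2)) * u) =
      Real.exp (-(2 * (1 - c ^ 2)) * u) * Real.exp (-(q ^ 2 * u)) * Real.exp (-(t ^ 2 * u)) := by
    rw [← Real.exp_add, ← Real.exp_add]
    congr 1
    ring
  simp only [feature]
  rw [mul_mul_mul_comm, Real.mul_self_sqrt hM, hE]
  have : (2 * c * (t * q) * u) ^ (2 * k + 1) =
      (2 * c * u) ^ (2 * k + 1) * q ^ (2 * k + 1) * t ^ (2 * k + 1) := by
    rw [← mul_pow, ← mul_pow]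
    congr 1
    ring
  rw [this]
  ring

theorem lintegral_exp_mul_sinh {D x A : ℝ} (hD : 0 ≤ D) (hx : 0 ≤ x) (hA : x < A) :
    ∫⁻ u in Ioi (0 : ℝ), ENNReal.ofReal (D * Real.exp (-A * u) * Real.sinh (x * u)) =
      ENNReal.ofReal (D / 2 * (1 / (A - x) - 1 / (A + x))) := by
  have h1 : -(A - x) < 0 := by linarith
  have h2 : -(A + x) < 0 := by linarith
  have e : ∀ u : ℝ, D * Real.exp (-A * u) * Real.sinh (x * u) =
      D / 2 * (Real.exp (-(A - x) * u) - Real.exp (-(A + x) * u)) := fun u => by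
    have e1 : Real.exp (-(A - x) * u) = Real.exp (-A * u) * Real.exp (x * u) := by
      rw [← Real.exp_add]; congr 1; ring
    have e2 : Real.exp (-(A + x) * u) = Real.exp (-A * u) * Real.exp (-(x * u)) := by
      rw [← Real.exp_add]; congr 1; ring
    rw [e1, e2, Real.sinh_eq]
    ring
  have i1 := integrableOn_exp_mul_Ioi h1 0
  have i2 := integrableOn_exp_mul_Ioi h2 0
  have hi : IntegrableOn (fun u => D * Real.exp (-A * u) * Real.sinh (x * u)) (Ioi 0) := by
    simp only [e]
    exact (i1.sub i2).const_mul _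
  rw [← ofReal_integral_eq_lintegral_ofReal hi]
  · simp only [e]
    rw [integral_const_mul, integral_sub i1 i2, integral_exp_mul_Ioi h1, integral_exp_mul_Ioi h2]
    simp only [mul_zero, Real.exp_zero, neg_div_neg_eq]
  · refine (ae_restrict_mem measurableSet_Ioi).mono fun u hu => ?_
    have : 0 ≤ Real.sinh (x * u) := Real.sinh_nonneg_iff.2 (mul_nonneg hx (le_of_lt hu))
    simp only [Pi.zero_apply]
    positivity

/-- For `t * q ≥ 0` all terms are nonnegative, so Tonelli allows summing the `sinh` series first and
integrating over `u` afterwards, with no prior integrability. -/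
theorem lintegral_feature_mul (hc0 : 0 ≤ c) (hc1 : c < 1) {t q : ℝ} (htq : 0 ≤ t * q) :
    ∫⁻ x, ENNReal.ofReal (feature c x q * feature c x t) ∂featureMeasure =
      ENNReal.ofReal (weightFun q * weightFun t * oddKernel c t q) := by
  have hc : c ^ 2 < 1 := by nlinarith
  have hm := (measurable_feature_mul c t q).ennreal_ofReal
  set A := t ^ 2 + q ^ 2 + 2 * (1 - c ^ 2) with hA
  set D := Real.sqrt (1 - c ^ 2) / Real.pi * weightFun q * weightFun t with hD
  have hD0 : 0 ≤ D := by
    have := weightFun_nonneg q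
    have := weightFun_nonneg t
    have := Real.pi_pos
    positivity
  have hx : 0 ≤ 2 * c * (t * q) := by positivity
  have hxA : 2 * c * (t * q) < A := by
    have := oddKernel_denom_pos hc t q
    rw [hA]; linarith
  rw [featureMeasure, lintegral_prod_symm _ hm.aemeasurable]
  have e : ∀ u ∈ Ioi (0 : ℝ),
      ∫⁻ k, ENNReal.ofReal (feature c (k, u) q * feature c (k, u) t) ∂Measure.count =
        ENNReal.ofReal (D * Real.exp (-A * u) * Real.sinh (2 * c * (t * q) * u)) := fun u hu => by
    have hu0 : 0 < u := hu
    rw [lintegral_count]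
    simp only [feature_mul_feature hc0 _ hu0 t q, ← hA, ← hD]
    have hs := (Real.hasSum_sinh (2 * c * (t * q) * u)).mul_left (D * Real.exp (-A * u))
    rw [← hs.tsum_eq, ENNReal.ofReal_tsum_of_nonneg (fun k => by positivity) hs.summable]
  rw [setLIntegral_congr_fun measurableSet_Ioi e, lintegral_exp_mul_sinh hD0 hx hxA]
  congr 1
  rw [oddKernel, hD, ← hA]
  simp only [← mul_assoc]
  ring

theorem integral_feature_mul (hc0 : 0 ≤ c) (hc1 : c < 1) (t q : ℝ) :
    ∫ x, feature c x q * feature c x t ∂featureMeasure =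
      weightFun q * weightFun t * oddKernel c t q := by
  have hc : c ^ 2 < 1 := by nlinarith
  -- Both sides are odd in `t`, so replacing `t` by `-t` restores the sign needed for Tonelli.
  wlog htq : 0 ≤ t * q generalizing t
  · have := this (-t) (by rw [neg_mul]; linarith)
    simp only [feature_neg, weightFun_neg, oddKernel_neg, mul_neg, integral_neg, neg_inj] at this
    exact this
  have hm := measurable_feature_mul c t q
  have hae : ∀ᵐ x ∂featureMeasure, 0 ≤ feature c x q * feature c x t := by
    have hu : ∀ᵐ x ∂featureMeasure, x.2 ∈ Ioi (0 : ℝ) :=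
      Measure.quasiMeasurePreserving_snd.ae (ae_restrict_mem measurableSet_Ioi)
    filter_upwards [hu] with x hx
    rw [feature_mul_feature hc0 x.1 hx t q]
    have := weightFun_nonneg q
    have := weightFun_nonneg t
    have := Real.pi_pos
    have : (0 : ℝ) < x.2 := hx
    positivity
  rw [integral_eq_lintegral_of_nonneg_ae hae hm.aestronglyMeasurable,
    lintegral_feature_mul hc0 hc1 htq, ENNReal.toReal_ofReal]
  refine mul_nonneg (mul_nonneg (weightFun_nonneg q) (weightFun_nonneg t)) ?_
  refine mul_nonneg (by have := Real.pi_pos; positivity) (sub_nonneg.2 ?_)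
  refine one_div_le_one_div_of_le (oddKernel_denom_pos hc t q) ?_
  have : 0 ≤ c * (t * q) := by positivity
  linarith

/-- At `q = t` the denominators factor as `2(1 ∓ c)(t² + (1 ± c))`, and their difference supplies
the factor `t²` that cancels the singularity of the weight at `0`. -/
theorem weightFun_mul_oddKernel_diag_le (hc0 : 0 ≤ c) (hc1 : c < 1) (t : ℝ) :
    weightFun t * weightFun t * oddKernel c t t ≤ diagMajorant c |t| := by
  have ha : 0 < 1 - c := by linarith
  have hs : 0 < Real.sqrt (1 - c ^ 2) := Real.sqrt_pos.2 (by nlinarith)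
  have hs2 : Real.sqrt (1 - c ^ 2) ^ 2 = (1 - c) * (1 + c) := by
    rw [Real.sq_sqrt (by nlinarith)]; ring
  have e : weightFun t * weightFun t * oddKernel c t t = 1 / (2 * Real.pi * Real.sqrt (1 - c ^ 2)) *
      (c * (weightFun t ^ 2 * t ^ 2) / ((t ^ 2 + (1 - c)) * (t ^ 2 + (1 + c)))) := by
    have e1 : t ^ 2 + t ^ 2 + 2 * (1 - c ^ 2) - 2 * c * t * t =
        2 * (1 - c) * (t ^ 2 + (1 + c)) := by ring
    have e2 : t ^ 2 + t ^ 2 + 2 * (1 - c ^ 2) + 2 * c * t * t =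
        2 * (1 + c) * (t ^ 2 + (1 - c)) := by ring
    rw [oddKernel, e1, e2]
    have := Real.pi_pos
    field_simp
    rw [hs2]
    ring
  rw [e, diagMajorant, sq_abs]
  have := Real.pi_pos
  gcongr
  exact weightFun_sq_mul_sq_le t

theorem lintegral_feature_sq_le (hc0 : 0 ≤ c) (hc1 : c < 1) :
    ∫⁻ z, ENNReal.ofReal (feature c z.1 z.2 ^ 2) ∂(featureMeasure.prod volume) ≤
      ENNReal.ofReal (diagBound c) := by
  rw [lintegral_prod_symm _ ((measurable_feature c).pow_const 2).ennreal_ofReal.aemeasurable,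
    ← lintegral_diagMajorant_abs hc0 hc1]
  refine lintegral_mono fun t => ?_
  simp only [sq]
  rw [lintegral_feature_mul hc0 hc1 (mul_self_nonneg t)]
  exact ENNReal.ofReal_le_ofReal (weightFun_mul_oddKernel_diag_le hc0 hc1 t)

theorem diagBound_nonneg (hc0 : 0 ≤ c) : 0 ≤ diagBound c := by
  have h1 := Real.artanh_nonneg hc0
  have h2 : Real.sqrt (1 - c) ≤ Real.sqrt (1 + c) := Real.sqrt_le_sqrt (by linarith)
  have := Real.pi_pos
  have := sub_nonneg.2 h2
  unfold diagBound
  positivity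

theorem integrable_feature_sq (hc0 : 0 ≤ c) (hc1 : c < 1) :
    Integrable (fun z : (ℕ × ℝ) × ℝ => feature c z.1 z.2 ^ 2) (featureMeasure.prod volume) := by
  refine ⟨((measurable_feature c).pow_const 2).aestronglyMeasurable, ?_⟩
  rw [hasFiniteIntegral_iff_ofReal (Filter.Eventually.of_forall fun z => sq_nonneg _)]
  exact (lintegral_feature_sq_le hc0 hc1).trans_lt ENNReal.ofReal_lt_top

theorem isHSKernel_feature (hc0 : 0 ≤ c) (hc1 : c < 1) :
    IsHSKernel (feature c) featureMeasure volume := by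
  refine (memLp_two_iff_integrable_sq_norm
    (Complex.measurable_ofReal.comp (measurable_feature c)).aestronglyMeasurable).2 ?_
  simpa using integrable_feature_sq hc0 hc1

theorem integral_feature_sq_le (hc0 : 0 ≤ c) (hc1 : c < 1) :
    ∫ x, (∫ t, feature c x t ^ 2) ∂featureMeasure ≤ diagBound c := by
  rw [← integral_prod _ (integrable_feature_sq hc0 hc1),
    integral_eq_lintegral_of_nonneg_ae (Filter.Eventually.of_forall fun z => sq_nonneg _)
      ((measurable_feature c).pow_const 2).aestronglyMeasurable]
  exact ENNReal.toReal_le_of_le_ofReal (diagBound_nonneg hc0) (lintegral_feature_sq_le hc0 hc1)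

/-- There is a positive trace class operator whose kernel is that of the sandwich operator. -/
theorem exists_traceNorm_le_and_ae_eq (hc0 : 0 ≤ c) (hc1 : c < 1) :
    ∃ P : L2 →L[ℂ] L2, traceNorm P ≤ ENNReal.ofReal (diagBound c) ∧
      ∀ φ : L2, P φ =ᵐ[volume] fun t =>
        ∫ q, ((weightFun q * weightFun t * oddKernel c t q : ℝ) : ℂ) * φ q := by
  have h := isHSKernel_feature hc0 hc1
  refine ⟨ContinuousLinearMap.adjoint h.op ∘L h.op, ?_, fun φ => ?_⟩
  · exact traceNorm_adjoint_mul_self_le _ fun w b s =>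
      (h.sum_norm_sq_le b.orthonormal s).trans (integral_feature_sq_le hc0 hc1)
  · simpa only [integral_feature_mul hc0 hc1] using h.adjoint_op_op_ae φ

end Feature

/-! ### Identification of the sandwich operator and symmetry in the angle. -/

section Sandwich

variable {θ : ℝ}

theorem sqrt_one_sub_cos_sq (hθ : θ ∈ Ioo 0 Real.pi) :
    Real.sqrt (1 - Real.cos θ ^ 2) = Real.sin θ := by
  rw [← Real.sin_sq, Real.sqrt_sq (Real.sin_pos_of_mem_Ioo hθ).le]

theorem cos_sq_lt_one (hθ : θ ∈ Ioo 0 Real.pi) : Real.cos θ ^ 2 < 1 := by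
  have := pow_pos (Real.sin_pos_of_mem_Ioo hθ) 2
  linarith [Real.sin_sq_add_cos_sq θ]

theorem hatTKernel_eq (hθ : θ ∈ Ioo 0 Real.pi) (t q : ℝ) : hatTKernel θ t q =
    Real.sin θ / Real.pi *
      (1 / (t ^ 2 + q ^ 2 + 2 * (1 - Real.cos θ ^ 2) - 2 * Real.cos θ * t * q)) := by
  have hs := Real.sin_pos_of_mem_Ioo hθ
  have hd := oddKernel_denom_pos (cos_sq_lt_one hθ) t q
  have hpi := Real.pi_pos
  rw [← Real.sin_sq] at hd ⊢
  have e : (t ^ 2 - 2 * Real.cos θ * t * q + q ^ 2) / (2 * Real.sin θ ^ 2) + 1 =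
      (t ^ 2 + q ^ 2 + 2 * Real.sin θ ^ 2 - 2 * Real.cos θ * t * q) / (2 * Real.sin θ ^ 2) := by
    field_simp
    ring
  rw [hatTKernel, abs_of_pos hs, e]
  field_simp

theorem half_hatTKernel_sub (hθ : θ ∈ Ioo 0 Real.pi) (t q : ℝ) :
    1 / 2 * (hatTKernel θ t q - hatTKernel θ (-t) q) = oddKernel (Real.cos θ) t q := by
  rw [hatTKernel_eq hθ, hatTKernel_eq hθ, oddKernel, sqrt_one_sub_cos_sq hθ, neg_sq]
  have e : t ^ 2 + q ^ 2 + 2 * (1 - Real.cos θ ^ 2) - 2 * Real.cos θ * -t * q =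
    t ^ 2 + q ^ 2 + 2 * (1 - Real.cos θ ^ 2) + 2 * Real.cos θ * t * q := by ring
  rw [e]
  ring

theorem measurable_hatTKernel (θ : ℝ) : Measurable fun z : ℝ × ℝ => hatTKernel θ z.1 z.2 := by
  unfold hatTKernel
  fun_prop

/-- By `2|tq| ≤ t² + q²`, the denominator is at least `(1 - |c|)((1 + t²) + (1 + q²))`. The
arithmetic–geometric mean inequality then gives an integrable product bound. -/
theorem hatTKernel_sq_le (hθ : θ ∈ Ioo 0 Real.pi) (t q : ℝ) : hatTKernel θ t q ^ 2 ≤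
    (Real.sin θ / Real.pi / (2 * (1 - |Real.cos θ|))) ^ 2 *
      ((1 + t ^ 2)⁻¹ * (1 + q ^ 2)⁻¹) := by
  have hs := Real.sin_pos_of_mem_Ioo hθ
  have hpi := Real.pi_pos
  have hc := cos_sq_lt_one hθ
  have hd := oddKernel_denom_pos hc t q
  have hc1 : |Real.cos θ| < 1 := (sq_lt_one_iff_abs_lt_one _).1 hc
  rw [hatTKernel_eq hθ]
  set c := Real.cos θ
  set D := t ^ 2 + q ^ 2 + 2 * (1 - c ^ 2) - 2 * c * t * q
  have ha : 0 < 1 - |c| := by linarith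
  have hD : (1 - |c|) * ((1 + t ^ 2) + (1 + q ^ 2)) ≤ D := by
    have h1 : 2 * (c * (t * q)) ≤ |c| * (t ^ 2 + q ^ 2) := by
      have h2 : c * (t * q) ≤ |c| * |t * q| := by rw [← abs_mul]; exact le_abs_self _
      have h3 : 2 * |t * q| ≤ t ^ 2 + q ^ 2 := by
        rw [abs_mul, ← sq_abs t, ← sq_abs q]
        nlinarith [sq_nonneg (|t| - |q|)]
      nlinarith [mul_le_mul_of_nonneg_left h3 (abs_nonneg c)]
    have h4 : c ^ 2 = |c| ^ 2 := (sq_abs c).symm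
    have h5 : 0 ≤ |c| * (1 - |c|) := mul_nonneg (abs_nonneg c) ha.le
    simp only [D]
    nlinarith
  have hD2 : (2 * (1 - |c|)) ^ 2 * ((1 + t ^ 2) * (1 + q ^ 2)) ≤ D ^ 2 := by
    have h := pow_le_pow_left₀ (by positivity) hD 2
    refine le_trans ?_ h
    have h6 : 4 * ((1 + t ^ 2) * (1 + q ^ 2)) ≤ ((1 + t ^ 2) + (1 + q ^ 2)) ^ 2 := by
      nlinarith [sq_nonneg ((1 + t ^ 2) - (1 + q ^ 2))]
    nlinarith [mul_le_mul_of_nonneg_left h6 (sq_nonneg (1 - |c|))]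
  have e1 : (Real.sin θ / Real.pi * (1 / D)) ^ 2 = (Real.sin θ / Real.pi) ^ 2 * (D ^ 2)⁻¹ := by
    rw [mul_pow, one_div, inv_pow]
  have e2 : (Real.sin θ / Real.pi / (2 * (1 - |c|))) ^ 2 * ((1 + t ^ 2)⁻¹ * (1 + q ^ 2)⁻¹) =
      (Real.sin θ / Real.pi) ^ 2 * ((2 * (1 - |c|)) ^ 2 * ((1 + t ^ 2) * (1 + q ^ 2)))⁻¹ := by
    rw [div_pow, mul_inv, mul_inv]
    ring
  rw [e1, e2]
  gcongr

theorem isHSKernel_hatTKernel (hθ : θ ∈ Ioo 0 Real.pi) :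
    IsHSKernel (hatTKernel θ) volume volume := by
  refine (memLp_two_iff_integrable_sq_norm
    (Complex.measurable_ofReal.comp (measurable_hatTKernel θ)).aestronglyMeasurable).2 ?_
  have hi : Integrable (fun z : ℝ × ℝ =>
      (Real.sin θ / Real.pi / (2 * (1 - |Real.cos θ|))) ^ 2 *
        ((1 + z.1 ^ 2)⁻¹ * (1 + z.2 ^ 2)⁻¹)) (volume.prod volume) :=
    (integrable_inv_one_add_sq.mul_prod integrable_inv_one_add_sq).const_mul _
  refine hi.mono' ?_ (Filter.Eventually.of_forall fun z => ?_)
  · exact ((Complex.measurable_ofReal.comp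
      (measurable_hatTKernel θ)).norm.pow_const 2).aestronglyMeasurable
  · simpa using hatTKernel_sq_le hθ z.1 z.2

theorem mem_hatT_domain (hθ : θ ∈ Ioo 0 Real.pi) (ψ : L2) : ψ ∈ (hatT θ).domain :=
  ⟨(isHSKernel_hatTKernel hθ).ae_integrable_mul (Lp.memLp ψ),
    (isHSKernel_hatTKernel hθ).memLp_integral ψ⟩

/-- Parity acts on the output variable, so it replaces `t` by `-t` in the kernel; the almost
everywhere identities are carried along because the reflection preserves null sets. -/
theorem hatTMinus_apply_ae (hθ : θ ∈ Ioo 0 Real.pi) (ψ : L2) :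
    hatTMinus θ ⟨ψ, mem_hatT_domain hθ ψ⟩ =ᵐ[volume] fun t =>
      ∫ q, (oddKernel (Real.cos θ) t q : ℂ) * ψ q := by
  have hmem := mem_hatT_domain hθ ψ
  set g : L2 := hatT θ ⟨ψ, hmem⟩ with hg
  have hgG : g =ᵐ[volume] fun t => ∫ q, (hatTKernel θ t q : ℂ) * ψ q :=
    ((isHSKernel_hatTKernel hθ).memLp_integral ψ).coeFn_toLp
  have hneg := Measure.measurePreserving_neg (volume : Measure ℝ)
  have hpar : parity g =ᵐ[volume] g ∘ fun t : ℝ => -t :=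
    Lp.coeFn_compMeasurePreserving g hneg
  have e : hatTMinus θ ⟨ψ, hmem⟩ = (1 / 2 : ℂ) • (g - parity g) := rfl
  rw [e]
  have hint := (isHSKernel_hatTKernel hθ).ae_integrable_mul (Lp.memLp ψ)
  filter_upwards [Lp.coeFn_smul (1 / 2 : ℂ) (g - parity g), Lp.coeFn_sub g (parity g), hpar, hgG,
    hneg.quasiMeasurePreserving.ae hgG, hint, hneg.quasiMeasurePreserving.ae hint]
    with t h1 h2 h3 h4 h5 h6 h7
  rw [h1, Pi.smul_apply, h2, Pi.sub_apply, h3, Function.comp_apply, h4, h5, ← integral_sub h6 h7,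
    ← integral_smul]
  refine integral_congr_ae (Filter.Eventually.of_forall fun q => ?_)
  simp only [← half_hatTKernel_sub hθ]
  push_cast
  rw [smul_eq_mul]
  ring

/-- If `ψ` is orthogonal to the domain, test it against `weightInv · ψ`, which lies in the domain:
this gives `∫ weightInv |ψ|² = 0`, and `weightInv > 0` away from `0`. -/
theorem dense_weight_domain : Dense (weight.domain : Set L2) := by
  rw [Submodule.dense_iff_topologicalClosure_eq_top, Submodule.topologicalClosure_eq_top_iff,
    Submodule.eq_bot_iff]
  intro ψ hψ
  have h0 : ∀ᵐ p : ℝ, p ≠ 0 := by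
    simp [ae_iff]
  have hm : MemLp (fun p => (weightInv p : ℂ) * ψ p) 2 volume := by
    refine (Lp.memLp ψ).mono ((Complex.measurable_ofReal.comp
      measurable_weightInv).aestronglyMeasurable.mul (Lp.aestronglyMeasurable ψ))
      (Filter.Eventually.of_forall fun p => ?_)
    rw [norm_mul, Complex.norm_real, Real.norm_of_nonneg (weightInv_nonneg p)]
    exact mul_le_of_le_one_left (norm_nonneg _) (weightInv_le_one p)
  have hmem : hm.toLp _ ∈ weight.domain := by
    refine (Lp.memLp ψ).ae_eq ?_
    filter_upwards [h0, hm.coeFn_toLp] with p hp h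
    change _ = (weightFun p : ℂ) * _
    rw [h, ← mul_assoc, ← Complex.ofReal_mul, weightFun_mul_weightInv hp, Complex.ofReal_one,
      one_mul]
  have h := (Submodule.mem_orthogonal _ _).1 hψ _ hmem
  rw [L2.inner_def] at h
  have h2 : ∫ p, weightInv p * ‖ψ p‖ ^ 2 = 0 := by
    rw [← Complex.ofReal_inj, ← integral_complex_ofReal, Complex.ofReal_zero, ← h]
    refine integral_congr_ae ?_
    filter_upwards [hm.coeFn_toLp] with p hp
    rw [hp, RCLike.inner_apply, map_mul, Complex.conj_ofReal]
    have := Complex.mul_conj' (ψ p)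
    push_cast
    rw [← this]
    ring
  have hi : Integrable (fun p => weightInv p * ‖ψ p‖ ^ 2) := by
    refine ((memLp_two_iff_integrable_sq_norm (Lp.memLp ψ).1).1 (Lp.memLp ψ)).mono'
      (measurable_weightInv.aestronglyMeasurable.mul ((Lp.aestronglyMeasurable ψ).norm.pow 2))
      (Filter.Eventually.of_forall fun p => ?_)
    rw [Real.norm_of_nonneg (mul_nonneg (weightInv_nonneg p) (sq_nonneg _))]
    exact mul_le_of_le_one_left (sq_nonneg _) (weightInv_le_one p)
  rw [integral_eq_zero_iff_of_nonneg
    (fun p => mul_nonneg (weightInv_nonneg p) (sq_nonneg _)) hi] at h2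
  rw [Lp.eq_zero_iff_ae_eq_zero]
  filter_upwards [h2, h0] with p hp hp0
  simpa [(weightInv_pos hp0).ne'] using hp

theorem isBoundedExtension_sandwich (hθ : θ ∈ Ioo 0 Real.pi) {P : L2 →L[ℂ] L2}
    (hP : ∀ φ : L2, P φ =ᵐ[volume] fun t =>
      ∫ q, ((weightFun q * weightFun t * oddKernel (Real.cos θ) t q : ℝ) : ℂ) * φ q) :
    IsBoundedExtension (sandwich θ) P := by
  -- The outer weight moves under the integral over `q`. As `P φ` is in L², this also shows that the
  -- second multiplication imposes no further domain condition.
  have key : ∀ φ (hφ : φ ∈ weight.domain),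
      (fun t => (weightFun t : ℂ) *
        hatTMinus θ ⟨weight ⟨φ, hφ⟩, mem_hatT_domain hθ _⟩ t) =ᵐ[volume] P φ := by
    intro φ hφ
    have hw : weight ⟨φ, hφ⟩ =ᵐ[volume] fun p => (weightFun p : ℂ) * φ p := MemLp.coeFn_toLp hφ
    filter_upwards [hatTMinus_apply_ae hθ (weight ⟨φ, hφ⟩), hP φ] with t h1 h2
    rw [h1, h2, ← integral_const_mul]
    refine integral_congr_ae ?_
    filter_upwards [hw] with q hq
    rw [hq]
    push_cast
    ring
  have hmem : ∀ φ (hφ : φ ∈ weight.domain),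
      hatTMinus θ ⟨weight ⟨φ, hφ⟩, mem_hatT_domain hθ _⟩ ∈ weight.domain := fun φ hφ =>
    (Lp.memLp (P φ)).ae_eq (key φ hφ).symm
  constructor
  · refine dense_weight_domain.mono fun φ hφ => ?_
    exact (mem_compNat_domain _ _ _).2
      ⟨(mem_compNat_domain _ _ _).2 ⟨hφ, mem_hatT_domain hθ _⟩, hmem φ hφ⟩
  · rintro ⟨φ, hφ⟩
    have hφw : φ ∈ weight.domain := by
      obtain ⟨h1, -⟩ := (mem_compNat_domain _ _ _).1 hφ
      exact ((mem_compNat_domain _ _ _).1 h1).1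
    have e : sandwich θ ⟨φ, hφ⟩ = weight
      ⟨hatTMinus θ ⟨weight ⟨φ, hφw⟩, mem_hatT_domain hθ _⟩, hmem φ hφw⟩ := rfl
    rw [e]
    refine Lp.ext ((MemLp.coeFn_toLp (hmem φ hφw)).trans (key φ hφw))

theorem oddKernel_neg_left (c t q : ℝ) : oddKernel (-c) t q = -oddKernel c t q := by
  unfold oddKernel
  rw [neg_sq]
  ring

/-- The operator `P` is chosen for each value of `c`, not of `θ`, and `T θ` is `P |cos θ|` up to the
sign of `cos θ`. The symmetry under `θ ↦ π - θ` then follows from `|cos (π - θ)| = |cos θ|`. -/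
theorem exists_family :
    ∃ T : ℝ → (L2 →L[ℂ] L2),
      (∀ θ ∈ Ioo 0 Real.pi, IsBoundedExtension (sandwich θ) (T θ) ∧
        traceNorm (T θ) ≤ ENNReal.ofReal (diagBound |Real.cos θ|)) ∧
      ∀ θ, traceNorm (T (Real.pi - θ)) = traceNorm (T θ) := by
  have hex : ∀ c : ℝ, ∃ P : L2 →L[ℂ] L2, 0 ≤ c → c < 1 →
      traceNorm P ≤ ENNReal.ofReal (diagBound c) ∧ ∀ φ : L2, P φ =ᵐ[volume] fun t =>
        ∫ q, ((weightFun q * weightFun t * oddKernel c t q : ℝ) : ℂ) * φ q := fun c => by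
    by_cases h : 0 ≤ c ∧ c < 1
    · obtain ⟨P, hP⟩ := exists_traceNorm_le_and_ae_eq h.1 h.2
      exact ⟨P, fun _ _ => hP⟩
    · exact ⟨0, fun h0 h1 => absurd ⟨h0, h1⟩ h⟩
  choose P hP using hex
  have htr : ∀ θ, traceNorm (if 0 ≤ Real.cos θ then P |Real.cos θ| else -P |Real.cos θ|) =
      traceNorm (P |Real.cos θ|) := fun θ => by
    split_ifs
    · rfl
    · exact traceNorm_neg _
  refine ⟨fun θ => if 0 ≤ Real.cos θ then P |Real.cos θ| else -P |Real.cos θ|,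
    fun θ hθ => ?_, fun θ => ?_⟩
  · obtain ⟨h1, h2⟩ := hP |Real.cos θ| (abs_nonneg _)
      ((sq_lt_one_iff_abs_lt_one _).1 (cos_sq_lt_one hθ))
    refine ⟨isBoundedExtension_sandwich hθ fun φ => ?_, (htr θ).trans_le h1⟩
    dsimp only
    split_ifs with hc
    · rw [abs_of_nonneg hc] at h2 ⊢
      exact h2 φ
    · have hc' : |Real.cos θ| = -Real.cos θ := abs_of_neg (not_le.1 hc)
      rw [hc'] at h2 ⊢
      filter_upwards [h2 φ, Lp.coeFn_neg (P (-Real.cos θ) φ)] with t h3 h4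
      rw [_root_.neg_apply, h4, Pi.neg_apply, h3, ← integral_neg]
      refine integral_congr_ae (Filter.Eventually.of_forall fun q => ?_)
      simp only [oddKernel_neg_left]
      push_cast
      ring
  · have e : |Real.cos (Real.pi - θ)| = |Real.cos θ| := by rw [Real.cos_pi_sub, abs_neg]
    exact (htr _).trans ((congrArg (fun c => traceNorm (P c)) e).trans (htr θ).symm)

end Sandwich

/-! ### Comparison with the stated bound, and its value at `π / 3`. -/

section Numerics

/-- With `θ = 2x`, the roots of `1 ± cos θ` become `√2 cos x` and `√2 sin x`. The two sides then
differ only by the term `4 sin² θ` multiplying `cos x - sin x`, which is nonnegative because `x < π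
/ 4`. -/
theorem diagBound_cos_le {θ : ℝ} (hθ : θ ∈ Ioo 0 (Real.pi / 2)) :
    diagBound (Real.cos θ) ≤
      (4 * Real.sin θ * Real.artanh (Real.cos θ) +
          Real.pi * (9 * Real.cos (θ / 2) - Real.cos (5 * θ / 2)
            - 9 * Real.sin (θ / 2) + Real.sin (5 * θ / 2))) /
        (4 * Real.pi * Real.sin θ ^ 2) := by
  have hpi := Real.pi_pos
  have hθ' : θ ∈ Ioo 0 Real.pi := ⟨hθ.1, by linarith [hθ.2]⟩
  have hsin := Real.sin_pos_of_mem_Ioo hθ'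
  obtain ⟨x, rfl⟩ : ∃ x, θ = 2 * x := ⟨θ / 2, by ring⟩
  have e5 : 5 * (2 * x) / 2 = 2 * (2 * x) + x := by ring
  have e1 : 2 * x / 2 = x := by ring
  have hx0 : 0 < x := by linarith [hθ.1]
  have hx4 : x < Real.pi / 4 := by linarith [hθ.2]
  have hS : 0 < Real.sin x := Real.sin_pos_of_pos_of_lt_pi hx0 (by linarith)
  have hC : 0 < Real.cos x := Real.cos_pos_of_mem_Ioo ⟨by linarith, by linarith⟩
  have h2 : Real.sqrt 2 ^ 2 = 2 := Real.sq_sqrt (by norm_num)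
  have hb : Real.sqrt (1 + Real.cos (2 * x)) = Real.sqrt 2 * Real.cos x := by
    rw [Real.cos_two_mul, Real.sqrt_eq_iff_mul_self_eq_of_pos (by positivity)]
    linear_combination Real.cos x ^ 2 * h2
  have ha : Real.sqrt (1 - Real.cos (2 * x)) = Real.sqrt 2 * Real.sin x := by
    rw [Real.cos_two_mul, Real.sqrt_eq_iff_mul_self_eq_of_pos (by positivity)]
    linear_combination Real.sin x ^ 2 * h2 + 2 * Real.sin_sq_add_cos_sq x
  have hCS : 0 ≤ Real.cos x - Real.sin x := by
    have h := Real.cos_pos_of_mem_Ioo (x := 2 * x) ⟨by linarith, by linarith⟩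
    rw [Real.cos_two_mul'] at h
    nlinarith
  rw [diagBound, sqrt_one_sub_cos_sq hθ', hb, ha, e5, e1]
  have hP : 9 * Real.cos x - Real.cos (2 * (2 * x) + x) - 9 * Real.sin x
      + Real.sin (2 * (2 * x) + x) =
      (Real.cos x - Real.sin x) * (8 + 2 * Real.sin (2 * x) + 4 * Real.sin (2 * x) ^ 2) := by
    rw [Real.cos_add, Real.sin_add, Real.cos_two_mul (2 * x), Real.sin_two_mul (2 * x),
      Real.cos_two_mul, Real.sin_two_mul]
    have hsc := Real.sin_sq_add_cos_sq x
    generalize Real.sin x = S at *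
    generalize Real.cos x = C at *
    have hS2 : S ^ 2 = 1 - C ^ 2 := by linarith
    grind
  rw [hP]
  have hfin : Real.artanh (Real.cos (2 * x)) / (Real.pi * Real.sin (2 * x)) +
      (Real.sqrt 2 * Real.cos x - Real.sqrt 2 * Real.sin x) * (Real.sin (2 * x) + 4) /
        (2 * Real.sqrt 2 * Real.sin (2 * x) ^ 2) =
      (4 * Real.sin (2 * x) * Real.artanh (Real.cos (2 * x)) + Real.pi *
        ((Real.cos x - Real.sin x) * (8 + 2 * Real.sin (2 * x)))) /
        (4 * Real.pi * Real.sin (2 * x) ^ 2) := by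
    field_simp
    ring
  rw [hfin]
  have hle : 8 + 2 * Real.sin (2 * x) ≤
      8 + 2 * Real.sin (2 * x) + 4 * Real.sin (2 * x) ^ 2 := by
    linarith [sq_nonneg (Real.sin (2 * x))]
  exact div_le_div_of_nonneg_right (add_le_add le_rfl
    (mul_le_mul_of_nonneg_left (mul_le_mul_of_nonneg_left hle hCS) hpi.le)) (by positivity)

theorem bound_pi_div_three :
    (4 * Real.sin (Real.pi / 3) * Real.artanh (Real.cos (Real.pi / 3)) +
          Real.pi * (9 * Real.cos (Real.pi / 3 / 2) - Real.cos (5 * (Real.pi / 3) / 2)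
            - 9 * Real.sin (Real.pi / 3 / 2) + Real.sin (5 * (Real.pi / 3) / 2))) /
        (4 * Real.pi * Real.sin (Real.pi / 3) ^ 2) =
      -4 / 3 + 5 / Real.sqrt 3 + Real.log 3 / (Real.sqrt 3 * Real.pi) := by
  have e1 : Real.pi / 3 / 2 = Real.pi / 6 := by ring
  have e2 : 5 * (Real.pi / 3) / 2 = Real.pi - Real.pi / 6 := by ring
  have h3 : Real.sqrt 3 ^ 2 = 3 := Real.sq_sqrt (by norm_num)
  have hs : 0 < Real.sqrt 3 := by positivity
  have hpi := Real.pi_pos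
  rw [e1, e2, Real.cos_pi_sub, Real.sin_pi_sub, Real.sin_pi_div_three, Real.cos_pi_div_three,
    Real.sin_pi_div_six, Real.cos_pi_div_six,
    Real.artanh_eq_half_log ⟨by norm_num, by norm_num⟩]
  have e3 : (1 + 1 / 2 : ℝ) / (1 - 1 / 2) = 3 := by norm_num
  rw [e3]
  field_simp
  linear_combination 16 * Real.pi * h3

theorem abs_bound_pi_div_three_sub_lt :
    |(-4 / 3 + 5 / Real.sqrt 3 + Real.log 3 / (Real.sqrt 3 * Real.pi)) - 1.75532| < 0.00001 := by
  have hs1 : 1.7320508 < Real.sqrt 3 := Real.lt_sqrt_of_sq_lt (by norm_num)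
  have hs2 : Real.sqrt 3 < 1.7320509 := (Real.sqrt_lt' (by norm_num)).2 (by norm_num)
  have hp1 := Real.pi_gt_d6
  have hp2 := Real.pi_lt_d6
  have hl1 := Real.log_three_gt_d9
  have hl2 := Real.log_three_lt_d9
  have hs : 0 < Real.sqrt 3 := by positivity
  have hpi := Real.pi_pos
  have a1 : 5 / Real.sqrt 3 < 5 / 1.7320508 := by gcongr
  have a2 : 5 / 1.7320509 < 5 / Real.sqrt 3 := by gcongr
  have b1 : Real.log 3 / (Real.sqrt 3 * Real.pi) < 1.0986122888 / (1.7320508 * 3.141592) := by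
    gcongr
  have b2 : 1.0986122885 / (1.7320509 * 3.141593) < Real.log 3 / (Real.sqrt 3 * Real.pi) := by
    gcongr
  rw [abs_lt]
  constructor
  · have : (-0.00001 : ℝ) < -4 / 3 + 5 / 1.7320509 + 1.0986122885 / (1.7320509 * 3.141593)
      - 1.75532 := by norm_num
    linarith
  · have : -4 / 3 + 5 / 1.7320508 + 1.0986122888 / (1.7320508 * 3.141592) - 1.75532
      < (0.00001 : ℝ) := by norm_num
    linarith

end Numerics

end Scissor

end

theorem mainTheorem5 :
    ∃ T : ℝ → (Scissor.L2 →L[ℂ] Scissor.L2),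
      (∀ θ ∈ Set.Ioo (0 : ℝ) Real.pi,
        Scissor.IsBoundedExtension (Scissor.sandwich θ) (T θ) ∧ Scissor.IsTraceClass (T θ)) ∧
      (∀ θ ∈ Set.Ioo (0 : ℝ) (Real.pi / 2),
        Scissor.traceNorm (T θ) ≤ ENNReal.ofReal
          ((4 * Real.sin θ * Real.artanh (Real.cos θ) +
              Real.pi * (9 * Real.cos (θ / 2) - Real.cos (5 * θ / 2)
                - 9 * Real.sin (θ / 2) + Real.sin (5 * θ / 2))) /
            (4 * Real.pi * Real.sin θ ^ 2))) ∧
      Scissor.traceNorm (T (2 * Real.pi / 3)) = Scissor.traceNorm (T (Real.pi / 3)) ∧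
      Scissor.traceNorm (T (2 * Real.pi / 3)) ≤ ENNReal.ofReal
        (-4 / 3 + 5 / Real.sqrt 3 + Real.log 3 / (Real.sqrt 3 * Real.pi)) ∧
      |(-4 / 3 + 5 / Real.sqrt 3 + Real.log 3 / (Real.sqrt 3 * Real.pi)) - 1.75532| < 0.00001 := by
  have hpi := Real.pi_pos
  obtain ⟨T, hT, hsymm⟩ := Scissor.exists_family
  have hbound : ∀ θ ∈ Set.Ioo (0 : ℝ) (Real.pi / 2),
      Scissor.traceNorm (T θ) ≤ ENNReal.ofReal
        ((4 * Real.sin θ * Real.artanh (Real.cos θ) +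
            Real.pi * (9 * Real.cos (θ / 2) - Real.cos (5 * θ / 2)
              - 9 * Real.sin (θ / 2) + Real.sin (5 * θ / 2))) /
          (4 * Real.pi * Real.sin θ ^ 2)) := fun θ hθ => by
    have h := (hT θ ⟨hθ.1, by linarith [hθ.2]⟩).2
    rw [abs_of_pos (Real.cos_pos_of_mem_Ioo ⟨by linarith [hθ.1], hθ.2⟩)] at h
    exact h.trans (ENNReal.ofReal_le_ofReal (Scissor.diagBound_cos_le hθ))
  have heq : Scissor.traceNorm (T (2 * Real.pi / 3)) = Scissor.traceNorm (T (Real.pi / 3)) := by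
    rw [← hsymm (Real.pi / 3)]
    congr 2
    ring
  refine ⟨T, fun θ hθ => ⟨(hT θ hθ).1, (hT θ hθ).2.trans_lt ENNReal.ofReal_lt_top⟩, hbound, heq,
    ?_, Scissor.abs_bound_pi_div_three_sub_lt⟩
  rw [heq, ← Scissor.bound_pi_div_three]
  exact hbound _ ⟨by positivity, by linarith⟩
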